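/- **Theorem (Validity of Mahi-Mahi, wave length 5).** Let $n=3f+1$ validators run the Mahi-Mahi protocol with wave length $5$ and $\ell$ leader slots per round, $1\le \ell\le 3f+1$, in the asynchronous model with a perfect global coin described below. Then, against every adversary, with probability $1$ (over the coin): if the run is admissible, every block broadcast by an honest validator is eventually delivered by every honest validator. *Blocks.* A block consists of an author, a round number $R\ge 1$, a list of transactions, an ordered list of references (ideal hashes) to distinct blocks of earlier rounds, and its author's coin share for its round; signatures are unforgeable. A block of round $R\ge 2$ is valid only if it references blocks of round $R-1$ by at least $2f+1$ distinct validators; all blocks in the causal history (everything reachable through references, including the block itself) have to be valid. The local DAG of a validator consists of the valid blocks whose whole causal history it has received. *System.* A run is a sequence of events chosen one at a time by an adversary. The adversary knows all past events and all coins revealed so far. It adaptively corrupts at most $f$ validators (a validator is *honest* if it is never corrupted); corrupted validators may send anything, except forged signatures; the adversary schedules all messages and all steps of uncorrupted validators, including the transactions in their blocks. An uncorrupted validator creates exactly one block per round, in order of rounds, and broadcasts it; for round $R\ge2$ its local DAG must contain blocks of round $R-1$ by at least $2f+1$ validators. Its block references only blocks in its local DAG, the first one being its own previous block, and has every block of an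 earlier round in its local DAG in its causal history. On receiving a block, an uncorrupted validator requests from the sender the blocks that it sees to be missing in its causal history; requests for blocks in the local DAG are answered. A run is *admissible* if every message between honest validators is eventually delivered and every honest validator that may propose its next block eventually proposes a block for that round. *Coin.* The coins of the different rounds are independent. The coin of round $r$ is a uniformly random ordering of the validators; the leaders of its slots $0,\dots,\ell-1$ are either the first $\ell$ validators of this ordering, or its first validator and those that follow it cyclically (the theorem holds for both variants). The coin of round $r$ becomes known to the adversary once the corrupted validators, together with the validators that have created a block of round $r+4$ while uncorrupted, number at least $2f+1$; it is known to a validator once its local DAG has blocks of round $r+4$ by at least $2f+1$ validators. Slots are ordered by round, then by index. *Decision rule, in a local DAG.* A block $c$ votes for a block $b$ if $b$ is the first block with its author and round that a depth-first search from $c$ along the references encounters. A *certificate* for a block $b$ of round $r$ is a block of round $r+4$ that references blocks of round $r+3$ by at least $2f+1$ validators that vote for $b$. Once the coin of round $r$ is known, a slot of round $r$ is directly committed with a block $b$ of the slot (a block of round $r$ by its leader) if at least $2f+1$ validators have certificates for $b$ in the DAG; it is directly skipped if the DAG has round-$(r+3)$ blocks of at least $2f+1$ validators and, for each block $b$ of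 the slot in the DAG, at least $2f+1$ validators have a round-$(r+3)$ block in the DAG that does not vote for $b$. If neither applies, consider the anchor, i.e. the first slot of a round greater than $r+4$ that is not skipped. If the anchor is committed with a block $a$, the slot is committed with a block $b$ of the slot if $a$ has a path to a certificate for $b$, and skipped if there is no such $b$. Otherwise the slot is undecided. *Delivery.* A validator delivers a block $b$ at slot $s$ if, in its local DAG at some time, $s$ is committed with a block having $b$ in its causal history, all earlier slots are decided (committed or skipped), and $b$ is not in the causal history of the block committed at an earlier slot. -/

import Mathlib

open MeasureTheory ProbabilityTheory

namespace MahiMahi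

/-! ### Blocks and the block graph

There are `n = 3 * f + 1` validators.  Hash functions and signatures are ideal: a hash reference
is identified with the block it refers to, so that a block is a finite tree, and signatures are
accounted for by the rules on who may introduce which block.  The coin share that a block carries
is determined by its author and its round. -/

/-- The validators. -/
abbrev Validator (f : ℕ) : Type := Fin (3 * f + 1)

/-- A block: author, round number, list of transactions, ordered list of referenced blocks. -/
inductive Block (f : ℕ) (Tx : Type*) where
  | mk (author : Validator f) (round : ℕ) (txs : List Tx) (parents : List (Block f Tx))

namespace Block

variable {f : ℕ} {Tx : Type*}

/-- The author of a block. -/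
def author : Block f Tx → Validator f
  | mk a _ _ _ => a

/-- The round number of a block. -/
def round : Block f Tx → ℕ
  | mk _ r _ _ => r

/-- The transactions of a block. -/
def txs : Block f Tx → List Tx
  | mk _ _ x _ => x

/-- The blocks referenced by a block, in order. -/
def parents : Block f Tx → List (Block f Tx)
  | mk _ _ _ ps => ps

end Block

/-- `InHistory a b`: there is a (possibly empty) path of references from `b` to `a`, i.e. `a` is in
the causal history of `b`. -/
def InHistory {f : ℕ} {Tx : Type*} (a b : Block f Tx) : Prop :=
  Relation.ReflTransGen (fun x y : Block f Tx => x ∈ y.parents) a b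

/-- The blocks in `S` come from at least `2 f + 1` distinct validators. -/
def HasQuorum {f : ℕ} {Tx : Type*} (S : Set (Block f Tx)) : Prop :=
  2 * f + 1 ≤ (Block.author '' S).ncard

/-- Validity conditions of a block on its own references (rounds start at `1`): all references are
distinct and point to earlier rounds and, after the first round, blocks of at least `2 f + 1`
distinct validators from the previous round are referenced. -/
def WellFormed {f : ℕ} {Tx : Type*} (b : Block f Tx) : Prop :=
  1 ≤ b.round ∧ b.parents.Nodup ∧ (∀ p ∈ b.parents, 1 ≤ p.round ∧ p.round < b.round) ∧
    (2 ≤ b.round → HasQuorum {p | p ∈ b.parents ∧ p.round + 1 = b.round})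

/-- The local DAG of a validator that has received the blocks in `R`: the blocks whose entire
causal history has been received and consists of well-formed blocks. -/
def localDag {f : ℕ} {Tx : Type*} (R : Set (Block f Tx)) : Set (Block f Tx) :=
  {b | ∀ a, InHistory a b → a ∈ R ∧ WellFormed a}

/-! ### Votes and certificates -/

mutual

/-- Depth-first search from a block, along its references in order, for the first block of author
`v` and round `r`. -/
def votedBlock {f : ℕ} {Tx : Type*} (v : Validator f) (r : ℕ) : Block f Tx → Option (Block f Tx)
  | .mk _ R _ ps => if R ≤ r then none else votedBlockAmong v r ps

/-- The loop of the depth-first search over a list of references. -/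
def votedBlockAmong {f : ℕ} {Tx : Type*} (v : Validator f) (r : ℕ) :
    List (Block f Tx) → Option (Block f Tx)
  | [] => none
  | b :: bs =>
    if b.author = v ∧ b.round = r then some b
    else
      match votedBlock v r b with
      | some x => some x
      | none => votedBlockAmong v r bs

end

/-- The block `c` is a vote for the block `b`. -/
def IsVote {f : ℕ} {Tx : Type*} (c b : Block f Tx) : Prop :=
  votedBlock b.author b.round c = some b

/-- With wave length `5`, the wave of propose round `r` consists of the rounds `r` (propose),
`r + 1`, `r + 2` (boost), `r + 3` (vote) and `r + 4` (certify). -/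
def voteRound (r : ℕ) : ℕ := r + 3

/-- The last round of the wave with propose round `r`. -/
def certifyRound (r : ℕ) : ℕ := r + 4

/-- The block `c` is a certificate for the block `b`: it is in the certify round of the wave of `b`
and references vote round blocks of at least `2 f + 1` distinct validators that vote for `b`. -/
def IsCert {f : ℕ} {Tx : Type*} (c b : Block f Tx) : Prop :=
  c.round = certifyRound b.round ∧
    HasQuorum {p | p ∈ c.parents ∧ p.round = voteRound b.round ∧ IsVote p b}

/-! ### The coin and the leader slots -/

/-- Values of the global coin: the coin of a round is a uniformly random ordering of the
validators. -/
abbrev Coin (f : ℕ) : Type := Equiv.Perm (Validator f)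

instance coinMeasurableSpace (f : ℕ) : MeasurableSpace (Coin f) := ⊤

/-- The law of the perfect coin: independent, uniformly distributed values, one for each round. -/
noncomputable def coinLaw (f : ℕ) : Measure (ℕ → Coin f) :=
  Measure.infinitePi fun _ => (PMF.uniformOfFintype (Coin f)).toMeasure

/-- The two ways in which the coin may be turned into leader slots. -/
inductive Election where
  /-- The leaders are a uniformly random validator and those that follow it cyclically. -/
  | consecutive
  /-- The leaders are drawn uniformly at random without replacement. -/
  | sample

/-- The validator elected by a coin value for the leader slot with index `j`. -/
def Election.leader {f : ℕ} (e : Election) (c : Coin f) (j : ℕ) : Validator f :=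
  match e with
  | .consecutive => c (Fin.ofNat (3 * f + 1) 0) + Fin.ofNat (3 * f + 1) j
  | .sample => c (Fin.ofNat (3 * f + 1) j)

/-- A leader slot: a propose round and an index below the number `ℓ` of leader slots per round. -/
structure Slot (ℓ : ℕ) where
  /-- The propose round. -/
  round : ℕ
  /-- The index of the slot within its round. -/
  idx : Fin ℓ

/-- The order in which slots are processed. -/
def Slot.Before {ℓ : ℕ} (s s' : Slot ℓ) : Prop :=
  s.round < s'.round ∨ (s.round = s'.round ∧ s.idx < s'.idx)

/-! ### The decision rule

In what follows `G` is the local DAG of a validator and `c` is the sequence of coin values; `c r` is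
the coin that elects the leaders of propose round `r`. -/

section Decision

variable {f : ℕ} {Tx : Type*} {ℓ : ℕ}

/-- The coin of propose round `r` can be reconstructed from `G`: it contains the shares, carried by
the blocks of the certify round, of at least `2 f + 1` validators. -/
def CoinAvailable (G : Set (Block f Tx)) (r : ℕ) : Prop :=
  HasQuorum {b | b ∈ G ∧ b.round = certifyRound r}

/-- The blocks of `G` in a slot (none, one, or several in case of equivocation). -/
def leaderBlocks (e : Election) (c : ℕ → Coin f) (G : Set (Block f Tx)) (s : Slot ℓ) :
    Set (Block f Tx) :=
  {b | b ∈ G ∧ b.round = s.round ∧ b.author = e.leader (c s.round) s.idx}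

/-- A block is directly committed: at least `2 f + 1` validators have certificates for it. -/
def Supported (G : Set (Block f Tx)) (b : Block f Tx) : Prop :=
  HasQuorum {d | d ∈ G ∧ IsCert d b}

/-- A block is directly skipped: at least `2 f + 1` validators have blocks in the vote round that
are not votes for it. -/
def Unsupported (G : Set (Block f Tx)) (b : Block f Tx) : Prop :=
  HasQuorum {d | d ∈ G ∧ d.round = voteRound b.round ∧ ¬ IsVote d b}

/-- The direct rule commits block `b` in slot `s`. -/
def DirectCommit (e : Election) (c : ℕ → Coin f) (G : Set (Block f Tx)) (s : Slot ℓ)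
    (b : Block f Tx) : Prop :=
  1 ≤ s.round ∧ CoinAvailable G s.round ∧ b ∈ leaderBlocks e c G s ∧ Supported G b

/-- The direct rule skips slot `s`: blocks of at least `2 f + 1` validators from the vote round are
present and every block in the slot (there may be none) is directly skipped. -/
def DirectSkip (e : Election) (c : ℕ → Coin f) (G : Set (Block f Tx)) (s : Slot ℓ) : Prop :=
  1 ≤ s.round ∧ CoinAvailable G s.round ∧
    HasQuorum {d | d ∈ G ∧ d.round = voteRound s.round} ∧
    ∀ b ∈ leaderBlocks e c G s, Unsupported G b

/-- The direct rule leaves slot `s` undecided although its leader is known. -/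
def DirectUndecided (e : Election) (c : ℕ → Coin f) (G : Set (Block f Tx)) (s : Slot ℓ) : Prop :=
  1 ≤ s.round ∧ CoinAvailable G s.round ∧ ¬ DirectSkip e c G s ∧ ∀ b, ¬ DirectCommit e c G s b

/-- The block `a` has a path to a certificate for `b` in `G`. -/
def CertifiedLink (G : Set (Block f Tx)) (a b : Block f Tx) : Prop :=
  ∃ d ∈ G, IsCert d b ∧ InHistory d a

/-- Classification of the slots in the local DAG `G`: `Decided e c G s (some b)` means that slot `s`
is committed with block `b`, and `Decided e c G s none` that it is skipped.  A slot that is neither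
is undecided.  In the indirect rule `s'` is the anchor of `s`: the first slot after the wave of `s`
that is not skipped; the slot stays undecided unless its anchor is committed. -/
inductive Decided (e : Election) (c : ℕ → Coin f) (G : Set (Block f Tx)) :
    Slot ℓ → Option (Block f Tx) → Prop
  | directCommit {s : Slot ℓ} {b : Block f Tx} (h : DirectCommit e c G s b) :
      Decided e c G s (some b)
  | directSkip {s : Slot ℓ} (h : DirectSkip e c G s) : Decided e c G s none
  | indirectCommit {s s' : Slot ℓ} {a b : Block f Tx} (h : DirectUndecided e c G s)
      (after : certifyRound s.round < s'.round)
      (first : ∀ u : Slot ℓ, certifyRound s.round < u.round → u.Before s' → Decided e c G u none)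
      (anchor : Decided e c G s' (some a))
      (mem : b ∈ leaderBlocks e c G s) (link : CertifiedLink G a b) :
      Decided e c G s (some b)
  | indirectSkip {s s' : Slot ℓ} {a : Block f Tx} (h : DirectUndecided e c G s)
      (after : certifyRound s.round < s'.round)
      (first : ∀ u : Slot ℓ, certifyRound s.round < u.round → u.Before s' → Decided e c G u none)
      (anchor : Decided e c G s' (some a))
      (noLink : ∀ b ∈ leaderBlocks e c G s, ¬ CertifiedLink G a b) :
      Decided e c G s none

/-- Block `b` is delivered at slot `s`, with leader block `l`: the slot is committed with `l`, all
earlier slots are decided, `b` is in the causal history of `l`, and `b` is not in the causal history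
of the leader block of an earlier slot. -/
def DeliveredAt (e : Election) (c : ℕ → Coin f) (G : Set (Block f Tx)) (b : Block f Tx)
    (s : Slot ℓ) (l : Block f Tx) : Prop :=
  Decided e c G s (some l) ∧ InHistory b l ∧
    (∀ u : Slot ℓ, 1 ≤ u.round → u.Before s → ∃ x, Decided e c G u x) ∧
    ∀ (u : Slot ℓ) (l' : Block f Tx), u.Before s → Decided e c G u (some l') → ¬ InHistory b l'

end Decision

/-! ### The asynchronous system -/

section System

variable {f : ℕ} {Tx : Type*}

/-- The content of a message: a block, or a request for the block with a given hash. -/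
inductive Body (f : ℕ) (Tx : Type*) where
  | block (b : Block f Tx)
  | request (b : Block f Tx)

/-- A message. -/
structure Msg (f : ℕ) (Tx : Type*) where
  /-- The sender. -/
  src : Validator f
  /-- The recipient. -/
  dst : Validator f
  /-- The content. -/
  body : Body f Tx

/-- A global state of the system. -/
structure State (f : ℕ) (Tx : Type*) where
  /-- The validators corrupted so far. -/
  corrupted : Set (Validator f)
  /-- The blocks signed and broadcast so far by validators that were honest at that time. -/
  created : Set (Block f Tx)
  /-- The blocks received so far by each validator, its own blocks included. -/
  received : Validator f → Set (Block f Tx)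
  /-- The messages sent so far by validators that were honest at that time. -/
  sent : Set (Msg f Tx)

/-- The state at the beginning. -/
def State.start (f : ℕ) (Tx : Type*) : State f Tx := ⟨∅, ∅, fun _ => ∅, ∅⟩

/-- The local DAG of validator `v`. -/
def State.dag (σ : State f Tx) (v : Validator f) : Set (Block f Tx) := localDag (σ.received v)

/-- The events, all scheduled by the adversary. -/
inductive Event (f : ℕ) (Tx : Type*) where
  /-- Nothing happens. -/
  | idle
  /-- A validator is corrupted. -/
  | corrupt (v : Validator f)
  /-- The author of `b`, an honest validator, creates and broadcasts `b`. -/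
  | create (b : Block f Tx)
  /-- A message reaches its recipient. -/
  | deliver (m : Msg f Tx)

/-- What an honest validator may propose: it creates one block in each round, in increasing order
of rounds; the block is valid and refers to blocks of its local DAG, starting with its own block of
the previous round, and all blocks of earlier rounds in its local DAG are (directly or transitively)
referred to.  The transactions, the precise choice and the order of the other references are left
to the adversary. -/
def CanCreate (σ : State f Tx) (b : Block f Tx) : Prop :=
  WellFormed b ∧
    (∀ r, 1 ≤ r → ((∃ d ∈ σ.created, d.author = b.author ∧ d.round = r) ↔ r < b.round)) ∧
    (∀ p ∈ b.parents, p ∈ σ.dag b.author) ∧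
    (2 ≤ b.round → ∃ d ∈ σ.created, d.author = b.author ∧ d.round + 1 = b.round ∧
      b.parents.head? = some d) ∧
    ∀ a ∈ σ.dag b.author, a.round < b.round → InHistory a b

/-- A corrupted validator may send any message, except that it cannot forge the signature of a
validator that has not been corrupted. -/
def Forgeable (σ : State f Tx) : Body f Tx → Prop
  | .block b => b.author ∈ σ.corrupted ∨ b ∈ σ.created
  | .request _ => True

/-- The events that may occur in a state.  At most `f` validators can be corrupted. -/
def Legal (σ : State f Tx) : Event f Tx → Prop
  | .idle => True
  | .corrupt v => (insert v σ.corrupted).ncard ≤ f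
  | .create b => b.author ∉ σ.corrupted ∧ CanCreate σ b
  | .deliver m => m ∈ σ.sent ∨ (m.src ∈ σ.corrupted ∧ Forgeable σ m.body)

/-- The blocks that a validator which has received the blocks in `R` sees to be missing in the
causal history of `b`: those referenced by a received block that can be reached from `b` through
received blocks, but not received themselves. -/
def missing (R : Set (Block f Tx)) (b : Block f Tx) : Set (Block f Tx) :=
  {q | q ∉ R ∧ ∃ p, Relation.ReflTransGen (fun x y : Block f Tx => x ∈ y.parents ∧ x ∈ R) p b ∧
    q ∈ p.parents}

open Classical in
/-- The reaction of an honest recipient to a message: a received block is stored and what is missing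
in its causal history is requested from the sender; a request for a block in the local DAG is
answered. -/
noncomputable def receive (σ : State f Tx) (m : Msg f Tx) : State f Tx :=
  match m.body with
  | .block b =>
    { σ with
      received := Function.update σ.received m.dst (insert b (σ.received m.dst))
      sent := σ.sent ∪
        {x | ∃ q ∈ missing (insert b (σ.received m.dst)) b, x = ⟨m.dst, m.src, .request q⟩} }
  | .request b =>
    if b ∈ σ.dag m.dst then { σ with sent := insert ⟨m.dst, m.src, .block b⟩ σ.sent } else σ

open Classical in
/-- The effect of an event; illegal events have none. -/
noncomputable def step (σ : State f Tx) (ev : Event f Tx) : State f Tx :=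
  if Legal σ ev then
    match ev with
    | .idle => σ
    | .corrupt v => { σ with corrupted := insert v σ.corrupted }
    | .create b =>
      { σ with
        created := insert b σ.created
        received := Function.update σ.received b.author (insert b (σ.received b.author))
        sent := σ.sent ∪ {x | ∃ w, w ≠ b.author ∧ x = ⟨b.author, w, .block b⟩} }
    | .deliver m => if m.dst ∈ σ.corrupted then σ else receive σ m
  else σ

/-- The state reached by a sequence of events, listed with the latest event first. -/
noncomputable def stateAfter (h : List (Event f Tx)) : State f Tx :=
  h.foldr (fun ev σ => step σ ev) (State.start f Tx)

/-- The adversary knows the coin of propose round `r`: the shares of the corrupted validators and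
those in the blocks created in the certify round amount to at least `2 f + 1` shares. -/
def CoinRevealed (σ : State f Tx) (r : ℕ) : Prop :=
  2 * f + 1 ≤
    (σ.corrupted ∪ {v | ∃ b ∈ σ.created, b.author = v ∧ b.round = certifyRound r}).ncard

open Classical in
/-- The coin values that the adversary knows. -/
noncomputable def coinView (σ : State f Tx) (c : ℕ → Coin f) (r : ℕ) : Option (Coin f) :=
  if CoinRevealed σ r then some (c r) else none

/-- An adaptive adversary with full control over the schedule: it chooses the next event, knowing all
events so far and all coins revealed so far, but no other coin. -/
abbrev Adversary (f : ℕ) (Tx : Type*) : Type _ :=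
  List (Event f Tx) → (ℕ → Option (Coin f)) → Event f Tx

/-- The first `t` events of the run with coin values `c`, latest event first. -/
noncomputable def history (A : Adversary f Tx) (c : ℕ → Coin f) : ℕ → List (Event f Tx)
  | 0 => []
  | t + 1 =>
    A (history A c t) (coinView (stateAfter (history A c t)) c) :: history A c t

/-- The state after `t` events. -/
noncomputable def stateAt (A : Adversary f Tx) (c : ℕ → Coin f) (t : ℕ) : State f Tx :=
  stateAfter (history A c t)

/-- The event with number `t`. -/
noncomputable def eventAt (A : Adversary f Tx) (c : ℕ → Coin f) (t : ℕ) : Event f Tx :=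
  A (history A c t) (coinView (stateAt A c t) c)

/-- A validator is honest in a run if it is never corrupted. -/
def Honest (A : Adversary f Tx) (c : ℕ → Coin f) (v : Validator f) : Prop :=
  ∀ t, v ∉ (stateAt A c t).corrupted

/-- Validator `v` is ready at time `t` to propose its block of round `r + 1`: it has proposed its
block of round `r` and its local DAG has blocks of at least `2 f + 1` validators from round `r`.
For the first round nothing is required. -/
def Ready (A : Adversary f Tx) (c : ℕ → Coin f) (v : Validator f) (r t : ℕ) : Prop :=
  r = 0 ∨ ((∃ b ∈ (stateAt A c t).created, b.author = v ∧ b.round = r) ∧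
    HasQuorum {b | b ∈ (stateAt A c t).dag v ∧ b.round = r})

/-- An admissible run of the asynchronous system: messages between honest validators are eventually
delivered, and honest validators eventually propose the blocks that they are ready to propose. -/
def Admissible (A : Adversary f Tx) (c : ℕ → Coin f) : Prop :=
  (∀ t, ∀ m ∈ (stateAt A c t).sent, Honest A c m.src → Honest A c m.dst →
    ∃ t', m ∈ (stateAt A c t').sent ∧ eventAt A c t' = .deliver m) ∧
  ∀ v, Honest A c v → ∀ r t, Ready A c v r t →
    ∃ t', ∃ b ∈ (stateAt A c t').created, b.author = v ∧ b.round = r + 1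

/-- Validator `v` broadcasts block `b` in the run. -/
def Broadcasts (A : Adversary f Tx) (c : ℕ → Coin f) (v : Validator f) (b : Block f Tx) : Prop :=
  b.author = v ∧ ∃ t, b ∈ (stateAt A c t).created

/-- With `ℓ` leader slots per round, validator `v` eventually delivers block `b` in the run. -/
def Delivers (A : Adversary f Tx) (ℓ : ℕ) (e : Election) (c : ℕ → Coin f) (v : Validator f)
    (b : Block f Tx) : Prop :=
  ∃ (t : ℕ) (s : Slot ℓ) (l : Block f Tx), DeliveredAt e c ((stateAt A c t).dag v) b s l

end System

end MahiMahi

namespace MahiMahi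

/-! ### Causal histories and votes -/

section Blocks

variable {f : ℕ} {Tx : Type*}

theorem InHistory.refl (b : Block f Tx) : InHistory b b := Relation.ReflTransGen.refl

theorem InHistory.trans {a b c : Block f Tx} (h : InHistory a b) (h' : InHistory b c) :
    InHistory a c := Relation.ReflTransGen.trans h h'

theorem InHistory.of_mem_parents {a b : Block f Tx} (h : a ∈ b.parents) : InHistory a b :=
  Relation.ReflTransGen.single h

theorem inHistory_iff {a b : Block f Tx} :
    InHistory a b ↔ a = b ∨ ∃ p ∈ b.parents, InHistory a p := by
  constructor
  · intro h
    rcases Relation.ReflTransGen.cases_tail h with h | ⟨p, hp, hb⟩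
    · exact Or.inl h.symm
    · exact Or.inr ⟨p, hb, hp⟩
  · rintro (rfl | ⟨p, hp, h⟩)
    · exact InHistory.refl _
    · exact h.trans (.of_mem_parents hp)

theorem sizeOf_lt_of_mem_parents {p b : Block f Tx} (h : p ∈ b.parents) :
    sizeOf p < sizeOf b := by
  cases b with
  | mk a r x ps =>
    have := List.sizeOf_lt_of_mem (show p ∈ ps from h)
    simp only [Block.mk.sizeOf_spec]
    omega

theorem finite_history (b : Block f Tx) : {a | InHistory a b}.Finite := by
  have : {a | InHistory a b} = insert b (⋃ p ∈ {p | p ∈ b.parents}, {a | InHistory a p}) := by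
    ext a
    simp only [Set.mem_ofPred_eq, Set.mem_insert_iff, Set.mem_iUnion, exists_prop]
    exact inHistory_iff
  rw [this]
  refine Set.Finite.insert _ (Set.Finite.biUnion (List.finite_toSet _) fun p hp => ?_)
  have := sizeOf_lt_of_mem_parents hp
  exact finite_history p
termination_by sizeOf b

theorem InHistory.round_le {a b : Block f Tx} (hb : ∀ x, InHistory x b → WellFormed x)
    (h : InHistory a b) : a.round ≤ b.round := by
  induction h with
  | refl => exact le_rfl
  | @tail x y hx hxy ih =>
    have h1 := ih fun z hz => hb z (hz.trans (.of_mem_parents hxy))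
    exact h1.trans (((hb y (.refl y)).2.2.1 x hxy).2.le)

theorem mem_localDag_of_inHistory {R : Set (Block f Tx)} {a b : Block f Tx}
    (hb : b ∈ localDag R) (h : InHistory a b) : a ∈ localDag R :=
  fun x hx => hb x (hx.trans h)

theorem localDag_mono {R R' : Set (Block f Tx)} (h : R ⊆ R') : localDag R ⊆ localDag R' :=
  fun _ hb a ha => ⟨h (hb a ha).1, (hb a ha).2⟩

theorem wellFormed_of_mem_localDag {R : Set (Block f Tx)} {b : Block f Tx}
    (hb : b ∈ localDag R) : WellFormed b := (hb b (.refl b)).2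

theorem HasQuorum.mono {S S' : Set (Block f Tx)} (h : HasQuorum S) (hS : S ⊆ S') :
    HasQuorum S' :=
  le_trans h (Set.ncard_le_ncard (Set.image_mono hS) (Set.toFinite _))

mutual

theorem votedBlock_sound (v : Validator f) (r : ℕ) :
    ∀ (c x : Block f Tx), votedBlock v r c = some x →
      InHistory x c ∧ x.author = v ∧ x.round = r
  | .mk a R txs ps, x => by
    intro h
    rw [votedBlock] at h
    split_ifs at h
    obtain ⟨p, hp, hx, h1⟩ := votedBlockAmong_sound v r ps x h
    exact ⟨hx.trans (.of_mem_parents hp), h1⟩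

theorem votedBlockAmong_sound (v : Validator f) (r : ℕ) :
    ∀ (ps : List (Block f Tx)) (x : Block f Tx), votedBlockAmong v r ps = some x →
      ∃ p ∈ ps, InHistory x p ∧ x.author = v ∧ x.round = r
  | [], x => by simp [votedBlockAmong]
  | b :: bs, x => by
    intro h
    rw [votedBlockAmong] at h
    split_ifs at h with h1
    · obtain rfl : b = x := by simpa using h
      exact ⟨b, by simp, .refl b, h1⟩
    · split at h
      · rename_i y hy
        obtain rfl : y = x := by simpa using h
        exact ⟨b, by simp, votedBlock_sound v r b y hy⟩
      · obtain ⟨p, hp, h2⟩ := votedBlockAmong_sound v r bs x h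
        exact ⟨p, by simp [hp], h2⟩

end

mutual

theorem votedBlock_ne_none (b : Block f Tx) :
    ∀ c : Block f Tx, (∀ x, InHistory x c → WellFormed x) → InHistory b c →
      b.round < c.round → votedBlock b.author b.round c ≠ none
  | .mk a R txs ps => by
    intro hw hb hr
    have hR : b.round < R := hr
    rw [votedBlock, if_neg (by omega)]
    rcases inHistory_iff.1 hb with rfl | ⟨p, hp, h⟩
    · exact absurd hr (lt_irrefl _)
    · exact votedBlockAmong_ne_none b ps
        (fun q hq x hx => hw x (hx.trans (.of_mem_parents hq))) ⟨p, hp, h⟩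

theorem votedBlockAmong_ne_none (b : Block f Tx) :
    ∀ ps : List (Block f Tx), (∀ q ∈ ps, ∀ x, InHistory x q → WellFormed x) →
      (∃ p ∈ ps, InHistory b p) → votedBlockAmong b.author b.round ps ≠ none
  | [] => by simp
  | q :: qs => by
    intro hw hb
    rw [votedBlockAmong]
    split_ifs with h1
    · simp
    · split
      · simp
      · rename_i hq
        refine votedBlockAmong_ne_none b qs (fun x hx => hw x (by simp [hx])) ?_
        obtain ⟨p, hp, h⟩ := hb
        rcases List.mem_cons.1 hp with hpq | hp
        · exfalso
          rw [hpq] at h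
          have hle := h.round_le (hw q (by simp))
          rcases hle.lt_or_eq with hlt | heq
          · exact votedBlock_ne_none b q (hw q (by simp)) h hlt hq
          · rcases inHistory_iff.1 h with rfl | ⟨z, hz, hbz⟩
            · exact h1 ⟨rfl, rfl⟩
            · have h2 := hbz.round_le
                fun x hx => hw q (by simp) x (hx.trans (.of_mem_parents hz))
              have h3 := ((hw q (by simp) q (.refl q)).2.2.1 z hz).2
              omega
        · exact ⟨p, hp, h⟩

end

theorem isVote_of_unique {b c : Block f Tx} (hw : ∀ x, InHistory x c → WellFormed x)
    (hb : InHistory b c) (hr : b.round < c.round)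
    (huniq : ∀ x, InHistory x c → x.author = b.author → x.round = b.round → x = b) :
    IsVote c b := by
  rcases hx : votedBlock b.author b.round c with _ | x
  · exact absurd hx (votedBlock_ne_none b c hw hb hr)
  · obtain ⟨h1, h2, h3⟩ := votedBlock_sound _ _ _ _ hx
    rw [IsVote, hx, huniq x h1 h2 h3]

end Blocks

/-! ### Invariants of the reachable states -/

section Invariants

variable {f : ℕ} {Tx : Type*}

theorem mem_dag_of_inHistory {σ : State f Tx} {v : Validator f} {a b : Block f Tx}
    (hb : b ∈ σ.dag v) (h : InHistory a b) : a ∈ σ.dag v :=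
  mem_localDag_of_inHistory hb h

theorem mem_received_of_mem_dag {σ : State f Tx} {v : Validator f} {b : Block f Tx}
    (hb : b ∈ σ.dag v) : b ∈ σ.received v := (hb b (.refl b)).1

/-- All components of the state have grown. -/
structure Grows (σ σ' : State f Tx) : Prop where
  corrupted : σ.corrupted ⊆ σ'.corrupted
  created : σ.created ⊆ σ'.created
  received : ∀ w, σ.received w ⊆ σ'.received w
  sent : σ.sent ⊆ σ'.sent

theorem Grows.refl (σ : State f Tx) : Grows σ σ :=
  ⟨subset_rfl, subset_rfl, fun _ => subset_rfl, subset_rfl⟩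

theorem Grows.trans {σ σ' σ'' : State f Tx} (h : Grows σ σ') (h' : Grows σ' σ'') :
    Grows σ σ'' :=
  ⟨h.1.trans h'.1, h.2.trans h'.2, fun w => (h.3 w).trans (h'.3 w), h.4.trans h'.4⟩

theorem Grows.dag {σ σ' : State f Tx} (h : Grows σ σ') (w : Validator f) :
    σ.dag w ⊆ σ'.dag w := localDag_mono (h.received w)

theorem subset_update_insert (R : Validator f → Set (Block f Tx)) (v w : Validator f)
    (b : Block f Tx) : R w ⊆ Function.update R v (insert b (R v)) w := by
  by_cases h : w = v
  · subst h
    simp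
  · simp [Function.update_of_ne h]

theorem grows_receive (σ : State f Tx) (m : Msg f Tx) : Grows σ (receive σ m) := by
  rcases m with ⟨v, w, b | b⟩
  · exact ⟨subset_rfl, subset_rfl, fun _ => subset_update_insert _ _ _ _,
      Set.subset_union_left⟩
  · simp only [receive]
    split_ifs
    · exact ⟨subset_rfl, subset_rfl, fun _ => subset_rfl, Set.subset_insert _ _⟩
    · exact Grows.refl σ

theorem grows_step (σ : State f Tx) (ev : Event f Tx) : Grows σ (step σ ev) := by
  unfold step
  split_ifs with hl
  · cases ev with
    | idle => exact Grows.refl σ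
    | corrupt v => exact ⟨Set.subset_insert _ _, subset_rfl, fun _ => subset_rfl, subset_rfl⟩
    | create b =>
      exact ⟨subset_rfl, Set.subset_insert _ _, fun _ => subset_update_insert _ _ _ _,
        Set.subset_union_left⟩
    | deliver m =>
      dsimp only
      split_ifs
      · exact Grows.refl σ
      · exact grows_receive σ m
  · exact Grows.refl σ

/-- The properties of reachable states on which the analysis of the protocol relies. -/
structure Inv (σ : State f Tx) : Prop where
  card_corrupted : σ.corrupted.ncard ≤ f
  unique : ∀ d ∈ σ.created, ∀ d' ∈ σ.created, d.author = d'.author → d.round = d'.round → d = d'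
  down : ∀ d ∈ σ.created, ∀ r, 1 ≤ r → r ≤ d.round →
    ∃ d' ∈ σ.created, d'.author = d.author ∧ d'.round = r
  finite : σ.created.Finite
  mem_dag : ∀ d ∈ σ.created, d ∈ σ.dag d.author
  genuine : ∀ w, ∀ x ∈ σ.received w, x.author ∈ σ.corrupted ∨ x ∈ σ.created
  sent_block : ∀ v w x, (⟨v, w, .block x⟩ : Msg f Tx) ∈ σ.sent → x ∈ σ.dag v
  sent_request : ∀ v w q, (⟨w, v, .request q⟩ : Msg f Tx) ∈ σ.sent → v ∉ σ.corrupted →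
    q ∈ σ.dag v
  broadcast : ∀ d ∈ σ.created, ∀ w, w ≠ d.author → (⟨d.author, w, .block d⟩ : Msg f Tx) ∈ σ.sent

theorem Inv.start : Inv (State.start f Tx) := by
  constructor <;> simp [State.start]

theorem Inv.corrupt {σ : State f Tx} (h : Inv σ) {v : Validator f}
    (hl : (insert v σ.corrupted).ncard ≤ f) :
    Inv { σ with corrupted := insert v σ.corrupted } where
  card_corrupted := hl
  unique := h.unique
  down := h.down
  finite := h.finite
  mem_dag := h.mem_dag
  genuine w x hx := (h.genuine w x hx).imp_left fun h => Set.mem_insert_of_mem _ h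
  sent_block := h.sent_block
  sent_request v w q hm hv := h.sent_request v w q hm fun h => hv (Set.mem_insert_of_mem _ h)
  broadcast := h.broadcast

theorem mem_localDag_of_parents {R : Set (Block f Tx)} {b : Block f Tx} (hR : b ∈ R)
    (hw : WellFormed b) (hp : ∀ p ∈ b.parents, p ∈ localDag R) : b ∈ localDag R := by
  intro a ha
  rcases inHistory_iff.1 ha with rfl | ⟨p, hpb, h⟩
  · exact ⟨hR, hw⟩
  · exact hp p hpb a h

theorem Inv.create {σ : State f Tx} (h : Inv σ) {b : Block f Tx}
    (hb : b.author ∉ σ.corrupted) (hc : CanCreate σ b) : Inv (step σ (.create b)) := by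
  have hg := grows_step σ (.create b)
  have hl : Legal σ (.create b) := ⟨hb, hc⟩
  rw [step, if_pos hl] at *
  obtain ⟨hw, hr, hp, -, -⟩ := hc
  have hnew : b ∈ State.dag { σ with
      created := insert b σ.created
      received := Function.update σ.received b.author (insert b (σ.received b.author))
      sent := σ.sent ∪ {x | ∃ w, w ≠ b.author ∧ x = ⟨b.author, w, .block b⟩} } b.author := by
    refine mem_localDag_of_parents ?_ hw fun p hpb => hg.dag _ (hp p hpb)
    simp
  have hfresh : ∀ d ∈ σ.created, d.author = b.author → d.round ≠ b.round := by
    intro d hd ha he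
    have h1 := (hr b.round hw.1).1 ⟨d, hd, ha, he⟩
    exact lt_irrefl _ h1
  constructor
  · exact h.card_corrupted
  · rintro d (rfl | hd) d' (rfl | hd') ha he
    · rfl
    · exact absurd he.symm (hfresh d' hd' ha.symm)
    · exact absurd he (hfresh d hd ha)
    · exact h.unique d hd d' hd' ha he
  · rintro d (rfl | hd) r h1 h2
    · rcases h2.lt_or_eq with h2 | rfl
      · obtain ⟨d', hd', h3⟩ := (hr r h1).2 h2
        exact ⟨d', Set.mem_insert_of_mem _ hd', h3⟩
      · exact ⟨d, Set.mem_insert _ _, rfl, rfl⟩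
    · obtain ⟨d', hd', h3⟩ := h.down d hd r h1 h2
      exact ⟨d', Set.mem_insert_of_mem _ hd', h3⟩
  · exact h.finite.insert _
  · rintro d (rfl | hd)
    · exact hnew
    · exact hg.dag _ (h.mem_dag d hd)
  · intro w x hx
    by_cases hwb : w = b.author
    · subst hwb
      simp only [Function.update_self] at hx
      rcases hx with rfl | hx
      · exact Or.inr (Set.mem_insert _ _)
      · exact (h.genuine _ x hx).imp_right fun h => Set.mem_insert_of_mem _ h
    · simp only [Function.update_of_ne hwb] at hx
      exact (h.genuine _ x hx).imp_right fun h => Set.mem_insert_of_mem _ h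
  · rintro v w x (hx | ⟨w', -, hx⟩)
    · exact hg.dag _ (h.sent_block v w x hx)
    · cases hx
      exact hnew
  · rintro v w x (hx | ⟨w', -, hx⟩) hv
    · exact hg.dag _ (h.sent_request v w x hx hv)
    · cases hx
  · rintro d (rfl | hd) w hw
    · exact Or.inr ⟨w, hw, rfl⟩
    · exact Or.inl (h.broadcast d hd w hw)

theorem inHistory_of_reachable {R : Set (Block f Tx)} {p b : Block f Tx}
    (h : Relation.ReflTransGen (fun x y : Block f Tx => x ∈ y.parents ∧ x ∈ R) p b) :
    InHistory p b := Relation.ReflTransGen.mono (fun _ _ h => h.1) _ _ h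

theorem Inv.receive {σ : State f Tx} (h : Inv σ) {m : Msg f Tx}
    (hl : Legal σ (.deliver m)) : Inv (receive σ m) := by
  have hg := grows_receive σ m
  rcases m with ⟨v, w, b | b⟩
  · simp only [MahiMahi.receive] at *
    constructor
    · exact h.card_corrupted
    · exact h.unique
    · exact h.down
    · exact h.finite
    · exact fun d hd => hg.dag _ (h.mem_dag d hd)
    · intro u x hx
      by_cases huw : u = w
      · subst huw
        simp only [Function.update_self] at hx
        rcases hx with rfl | hx
        · rcases hl with hs | ⟨-, hf⟩
          · exact h.genuine v x (mem_received_of_mem_dag (h.sent_block _ _ _ hs))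
          · exact hf
        · exact h.genuine _ x hx
      · simp only [Function.update_of_ne huw] at hx
        exact h.genuine _ x hx
    · rintro v' w' x (hx | ⟨q, hq, hx⟩)
      · exact hg.dag _ (h.sent_block _ _ x hx)
      · cases hx
    · rintro v' w' q (hx | ⟨q', hq, hx⟩) hv
      · exact hg.dag _ (h.sent_request _ _ _ hx hv)
      · cases hx
        obtain ⟨-, p, hp, hqp⟩ := hq
        rcases hl with hs | ⟨hv', -⟩
        · exact hg.dag _ (mem_dag_of_inHistory (h.sent_block _ _ _ hs)
            ((InHistory.of_mem_parents hqp).trans (inHistory_of_reachable hp)))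
        · exact absurd hv' hv
    · exact fun d hd w hw => Or.inl (h.broadcast d hd w hw)
  · simp only [MahiMahi.receive] at *
    split_ifs with hb
    · constructor
      · exact h.card_corrupted
      · exact h.unique
      · exact h.down
      · exact h.finite
      · exact h.mem_dag
      · exact h.genuine
      · rintro v' w' x (hx | hx)
        · cases hx
          exact hb
        · exact h.sent_block _ _ x hx
      · rintro v' w' x (hx | hx) hv
        · cases hx
        · exact h.sent_request _ _ x hx hv
      · exact fun d hd w hw => Or.inr (h.broadcast d hd w hw)
    · exact h

theorem Inv.step {σ : State f Tx} (h : Inv σ) (ev : Event f Tx) : Inv (step σ ev) := by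
  by_cases hl : Legal σ ev
  · cases ev with
    | idle => rwa [MahiMahi.step, if_pos hl]
    | corrupt v =>
      rw [MahiMahi.step, if_pos hl]
      exact h.corrupt hl
    | create b => exact h.create hl.1 hl.2
    | deliver m =>
      rw [MahiMahi.step, if_pos hl]
      split_ifs
      · exact h
      · exact h.receive hl
  · unfold MahiMahi.step
    rwa [if_neg hl]

theorem inv_stateAfter (h : List (Event f Tx)) : Inv (stateAfter h) := by
  induction h with
  | nil => exact Inv.start
  | cons ev h ih => exact ih.step ev

theorem Inv.author_created {σ : State f Tx} (h : Inv σ) {w : Validator f} {b x : Block f Tx}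
    (hb : b ∈ σ.dag w) (hx : InHistory x b) (hc : x.author ∉ σ.corrupted) : x ∈ σ.created :=
  (h.genuine w x (hb x hx).1).resolve_left hc

theorem CoinRevealed.of_le {σ : State f Tx} (h : Inv σ) {r r' : ℕ} (hr : r ≤ r')
    (hc : CoinRevealed σ r') : CoinRevealed σ r := by
  refine le_trans hc (Set.ncard_le_ncard ?_ (Set.toFinite _))
  refine Set.union_subset_union_right _ ?_
  rintro v ⟨b, hb, rfl, hbr⟩
  obtain ⟨d, hd, h1, h2⟩ := h.down b hb (certifyRound r) (by simp [certifyRound])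
    (by simp only [certifyRound] at *; omega)
  exact ⟨d, hd, h1, h2⟩

/-! ### Runs -/

variable {A : Adversary f Tx} {c : ℕ → Coin f}

theorem stateAt_succ (t : ℕ) : stateAt A c (t + 1) = step (stateAt A c t) (eventAt A c t) := rfl

theorem inv_stateAt (A : Adversary f Tx) (c : ℕ → Coin f) (t : ℕ) : Inv (stateAt A c t) :=
  inv_stateAfter _

theorem grows_stateAt {s t : ℕ} (h : s ≤ t) : Grows (stateAt A c s) (stateAt A c t) := by
  induction h with
  | refl => exact Grows.refl _
  | step _ ih => exact ih.trans (grows_step _ _)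

/-- A created block satisfies the conditions for proposals at the time of its creation. -/
theorem exists_create {t : ℕ} {b : Block f Tx} (hb : b ∈ (stateAt A c t).created) :
    ∃ s < t, b ∉ (stateAt A c s).created ∧ b ∈ (stateAt A c (s + 1)).created ∧
      CanCreate (stateAt A c s) b := by
  induction t with
  | zero => exact absurd hb (Set.notMem_empty b)
  | succ t ih =>
    by_cases h : b ∈ (stateAt A c t).created
    · obtain ⟨s, hs, h1⟩ := ih h
      exact ⟨s, by omega, h1⟩
    · refine ⟨t, by omega, h, hb, ?_⟩
      rw [stateAt_succ] at hb
      unfold step at hb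
      split_ifs at hb with hl
      · generalize eventAt A c t = ev at hb hl
        cases ev with
        | idle => exact absurd hb h
        | corrupt v => exact absurd hb h
        | create b' =>
          rcases hb with rfl | hb
          · exact hl.2
          · exact absurd hb h
        | deliver m =>
          dsimp only at hb
          split_ifs at hb
          · exact absurd hb h
          · rcases m with ⟨v, w, x | x⟩
            · exact absurd hb h
            · simp only [receive] at hb
              split_ifs at hb
              · exact absurd hb h
              · exact absurd hb h
      · exact absurd hb h

end Invariants

/-! ### Progress of admissible runs -/

section Progress

variable {f : ℕ} {Tx : Type*} {A : Adversary f Tx} {c : ℕ → Coin f}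

theorem stateAt_succ_of_deliver {t : ℕ} {m : Msg f Tx} (hm : m ∈ (stateAt A c t).sent)
    (he : eventAt A c t = .deliver m) (hd : Honest A c m.dst) :
    stateAt A c (t + 1) = receive (stateAt A c t) m := by
  have hl : Legal (stateAt A c t) (.deliver m) := Or.inl hm
  rw [stateAt_succ, he, step, if_pos hl]
  exact if_neg (hd t)

/-- Requests of honest validators to honest validators are answered. -/
theorem exists_answer (hA : Admissible A c) {v w : Validator f} (hv : Honest A c v)
    (hw : Honest A c w) {t : ℕ} {q : Block f Tx}
    (hq : (⟨w, v, .request q⟩ : Msg f Tx) ∈ (stateAt A c t).sent) :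
    ∃ t', (⟨v, w, .block q⟩ : Msg f Tx) ∈ (stateAt A c t').sent := by
  obtain ⟨s, hs, he⟩ := hA.1 t _ hq hw hv
  refine ⟨s + 1, ?_⟩
  rw [stateAt_succ_of_deliver hs he hv]
  have := (inv_stateAt A c s).sent_request v w q hs (hv s)
  simp [receive, this]

/-- The history of a block sent by one honest validator to another one is eventually received. -/
theorem exists_received_of_sent (hA : Admissible A c) {v w : Validator f} (hv : Honest A c v)
    (hw : Honest A c w) {t : ℕ} {b : Block f Tx}
    (hb : (⟨v, w, .block b⟩ : Msg f Tx) ∈ (stateAt A c t).sent) {a : Block f Tx}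
    (ha : InHistory a b) : ∃ t', a ∈ (stateAt A c t').received w := by
  have key : ∀ x, InHistory x b → ∃ s p, (⟨v, w, .block p⟩ : Msg f Tx) ∈ (stateAt A c s).sent ∧
      eventAt A c s = .deliver ⟨v, w, .block p⟩ ∧
      Relation.ReflTransGen
        (fun x y : Block f Tx => x ∈ y.parents ∧ x ∈ insert p ((stateAt A c s).received w)) x p := by
    intro x hx
    induction hx using Relation.ReflTransGen.head_induction_on with
    | refl =>
      obtain ⟨s, hs, he⟩ := hA.1 t _ hb hv hw
      exact ⟨s, b, hs, he, .refl⟩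
    | @head x y hxy _ ih =>
      obtain ⟨s, p, hs, he, hp⟩ := ih
      by_cases hx : x ∈ insert p ((stateAt A c s).received w)
      · exact ⟨s, p, hs, he, hp.head ⟨hxy, hx⟩⟩
      · have hreq : (⟨w, v, .request x⟩ : Msg f Tx) ∈ (stateAt A c (s + 1)).sent := by
          rw [stateAt_succ_of_deliver hs he hw]
          exact Or.inr ⟨x, ⟨hx, y, hp, hxy⟩, rfl⟩
        obtain ⟨s', hs'⟩ := exists_answer hA hv hw hreq
        obtain ⟨s'', hs'', he''⟩ := hA.1 s' _ hs' hv hw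
        exact ⟨s'', x, hs'', he'', .refl⟩
  obtain ⟨s, p, hs, he, hp⟩ := key a ha
  refine ⟨s + 1, ?_⟩
  rw [stateAt_succ_of_deliver hs he hw]
  simp only [receive, Function.update_self]
  rcases Relation.ReflTransGen.cases_head hp with rfl | ⟨y, hy, -⟩
  · exact Set.mem_insert _ _
  · exact hy.2

theorem exists_mem_dag_of_created (hA : Admissible A c) {b : Block f Tx} {t : ℕ}
    (hb : b ∈ (stateAt A c t).created) (hv : Honest A c b.author) {w : Validator f}
    (hw : Honest A c w) : ∃ t', b ∈ (stateAt A c t').dag w := by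
  have hdag := (inv_stateAt A c t).mem_dag b hb
  by_cases hwb : w = b.author
  · exact ⟨t, hwb ▸ hdag⟩
  · have hm := (inv_stateAt A c t).broadcast b hb w hwb
    have hrec : ∀ a, ∃ s, InHistory a b → a ∈ (stateAt A c s).received w := by
      intro a
      by_cases ha : InHistory a b
      · obtain ⟨s, hs⟩ := exists_received_of_sent hA hv hw hm ha
        exact ⟨s, fun _ => hs⟩
      · exact ⟨0, fun h => absurd h ha⟩
    choose s hs using hrec
    obtain ⟨M, hM⟩ := ((finite_history b).image s).bddAbove
    exact ⟨M, fun a ha => ⟨(grows_stateAt (hM ⟨a, ha, rfl⟩)).received w (hs a ha), (hdag a ha).2⟩⟩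

/-- Finitely many monotone properties that eventually hold hold simultaneously. -/
theorem exists_forall_of_eventually {ι : Type*} [Finite ι] {P : ι → ℕ → Prop}
    (hmono : ∀ i s t, s ≤ t → P i s → P i t) (h : ∀ i, ∃ t, P i t) : ∃ t, ∀ i, P i t := by
  choose t ht using h
  obtain ⟨M, hM⟩ := (Set.finite_range t).bddAbove
  exact ⟨M, fun i => hmono i _ _ (hM ⟨i, rfl⟩) (ht i)⟩

/-- After some time no validator is corrupted any more. -/
theorem exists_corrupted_stable (A : Adversary f Tx) (c : ℕ → Coin f) :
    ∃ t₀, ∀ v, v ∉ (stateAt A c t₀).corrupted → Honest A c v := by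
  obtain ⟨t₀, h⟩ := exists_forall_of_eventually
    (P := fun (v : Validator f) t => v ∉ (stateAt A c t).corrupted → Honest A c v)
    (fun v s t hst h hv => h fun h' => hv ((grows_stateAt hst).corrupted h')) (fun v => by
      by_cases hv : Honest A c v
      · exact ⟨0, fun _ => hv⟩
      · obtain ⟨t, ht⟩ := not_forall.1 hv
        exact ⟨t, fun h => absurd h ht⟩)
  exact ⟨t₀, h⟩

theorem honest_card (A : Adversary f Tx) (c : ℕ → Coin f) :
    2 * f + 1 ≤ {v | Honest A c v}.ncard := by
  obtain ⟨t₀, h⟩ := exists_corrupted_stable A c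
  have h1 : {v | Honest A c v}ᶜ ⊆ (stateAt A c t₀).corrupted := by
    intro v hv
    by_contra hc
    exact hv (h v hc)
  have h2 := Set.ncard_le_ncard h1 (Set.toFinite _)
  have h3 := (inv_stateAt A c t₀).card_corrupted
  have h4 := Set.ncard_add_ncard_compl {v | Honest A c v}
  rw [Nat.card_eq_fintype_card, Fintype.card_fin] at h4
  omega

theorem HasQuorum.of_honest {S : Set (Block f Tx)}
    (h : ∀ v, Honest A c v → ∃ b ∈ S, b.author = v) : HasQuorum S :=
  (honest_card A c).trans (Set.ncard_le_ncard h (Set.toFinite _))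

/-- Honest validators create blocks in all rounds. -/
theorem exists_created (hA : Admissible A c) (r : ℕ) :
    ∀ v, Honest A c v → ∃ t, ∃ b ∈ (stateAt A c t).created, b.author = v ∧ b.round = r + 1 := by
  induction r with
  | zero => exact fun v hv => hA.2 v hv 0 0 (Or.inl rfl)
  | succ r ih =>
    intro v hv
    have h1 : ∀ w, ∃ t, Honest A c w →
        ∃ b ∈ (stateAt A c t).dag v, b.author = w ∧ b.round = r + 1 := by
      intro w
      by_cases hw : Honest A c w
      · obtain ⟨t, b, hb, rfl, hr⟩ := ih w hw
        obtain ⟨t', h⟩ := exists_mem_dag_of_created hA hb hw hv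
        exact ⟨t', fun _ => ⟨b, h, rfl, hr⟩⟩
      · exact ⟨0, fun h => absurd h hw⟩
    obtain ⟨t, ht⟩ := exists_forall_of_eventually (fun w s t hst h hw => by
      obtain ⟨b, hb, h1⟩ := h hw
      exact ⟨b, (grows_stateAt hst).dag v hb, h1⟩) h1
    obtain ⟨t', b, hb, hb'⟩ := ih v hv
    refine hA.2 v hv (r + 1) (max t t') (Or.inr
      ⟨⟨b, (grows_stateAt (le_max_right _ _)).created hb, hb'⟩, ?_⟩)
    refine HasQuorum.of_honest (A := A) (c := c) fun w hw => ?_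
    obtain ⟨d, hd, h2, h3⟩ := ht w hw
    exact ⟨d, ⟨(grows_stateAt (le_max_left _ _)).dag v hd, h3⟩, h2⟩

/-- The blocks of honest validators from any finite number of rounds are eventually in the local
DAG of every honest validator. -/
theorem exists_mem_dag (hA : Admissible A c) {w : Validator f} (hw : Honest A c w) (M : ℕ) :
    ∃ t₀, ∀ t ≥ t₀, ∀ v, Honest A c v → ∀ r, 1 ≤ r → r ≤ M →
      ∃ b ∈ (stateAt A c t).dag w, b ∈ (stateAt A c t).created ∧ b.author = v ∧ b.round = r := by
  have hmono : ∀ (i : Validator f × Fin M) (s t : ℕ), s ≤ t →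
      (Honest A c i.1 → ∃ b ∈ (stateAt A c s).dag w, b ∈ (stateAt A c s).created ∧
        b.author = i.1 ∧ b.round = i.2 + 1) →
      (Honest A c i.1 → ∃ b ∈ (stateAt A c t).dag w, b ∈ (stateAt A c t).created ∧
        b.author = i.1 ∧ b.round = i.2 + 1) := by
    intro i s t hst h hi
    obtain ⟨b, hb, hb', h1⟩ := h hi
    exact ⟨b, (grows_stateAt hst).dag w hb, (grows_stateAt hst).created hb', h1⟩
  obtain ⟨t₀, ht₀⟩ := exists_forall_of_eventually hmono (by
    rintro ⟨v, r⟩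
    by_cases hv : Honest A c v
    · obtain ⟨t, b, hb, rfl, hr⟩ := exists_created hA r v hv
      obtain ⟨t', h⟩ := exists_mem_dag_of_created hA hb hv hw
      exact ⟨max t t', fun _ => ⟨b, (grows_stateAt (le_max_right _ _)).dag w h,
        (grows_stateAt (le_max_left _ _)).created hb, rfl, hr⟩⟩
    · exact ⟨0, fun h => absurd h hv⟩)
  refine ⟨t₀, fun t ht v hv r h1 h2 => ?_⟩
  obtain ⟨b, hb, hb', h3, h4⟩ := hmono (v, ⟨r - 1, by omega⟩) t₀ t ht (ht₀ _) hv
  refine ⟨b, hb, hb', h3, ?_⟩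
  simp only at h4
  omega

end Progress

/-! ### The common core -/

section Core

variable {f : ℕ} {Tx : Type*}

/-- The block `b` of round `r`, whose author is not corrupted, is in the causal history of all
blocks that not corrupted validators have created in round `r + 2`. -/
def CoreBlock (σ : State f Tx) (r : ℕ) (b : Block f Tx) : Prop :=
  b ∈ σ.created ∧ b.round = r ∧ b.author ∉ σ.corrupted ∧
    ∀ d ∈ σ.created, d.author ∉ σ.corrupted → d.round = r + 2 → InHistory b d

theorem CoinRevealed.exists_creator {σ : State f Tx} (h : Inv σ) {r : ℕ} (hc : CoinRevealed σ r)
    {k : ℕ} (hk : 1 ≤ r + k) (hk4 : k ≤ 4) {S : Set (Validator f)} (hS : 2 * f + 1 ≤ S.ncard) :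
    ∃ d ∈ σ.created, d.author ∈ S ∧ d.author ∉ σ.corrupted ∧ d.round = r + k := by
  set K := {v | ∃ b ∈ σ.created, b.author = v ∧ b.round = certifyRound r} with hK
  have hc' : 2 * f + 1 ≤ (σ.corrupted ∪ K).ncard := hc
  by_contra! hcon
  have hsub : S ∩ (σ.corrupted ∪ K) ⊆ σ.corrupted := by
    rintro v ⟨hvS, hv | ⟨b, hb, rfl, hr⟩⟩
    · exact hv
    · by_contra hvc
      obtain ⟨d, hd, h1, h2⟩ := h.down b hb (r + k) hk (by rw [hr, certifyRound]; omega)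
      exact hcon d hd (h1 ▸ hvS) (h1 ▸ hvc) h2
  have h1 := Set.ncard_le_ncard hsub (Set.toFinite _)
  have h2 := h.card_corrupted
  have h3 := Set.ncard_union_add_ncard_inter S (σ.corrupted ∪ K)
  have h4 : (S ∪ (σ.corrupted ∪ K)).ncard ≤ 3 * f + 1 := by
    have := Set.ncard_le_ncard (Set.subset_univ (S ∪ (σ.corrupted ∪ K))) (Set.toFinite _)
    rwa [Set.ncard_univ, Nat.card_eq_fintype_card, Fintype.card_fin] at this
  omega

open Classical in
/-- The not corrupted validators with referenced blocks in the previous round. -/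
theorem WellFormed.card_parents {b : Block f Tx} (hb : WellFormed b) {r : ℕ} (hr : b.round = r + 1)
    (hr1 : 1 ≤ r) (C : Finset (Validator f)) :
    2 * f + 1 ≤ (Cᶜ.filter fun v => ∃ p ∈ b.parents, p.author = v ∧ p.round = r).card + C.card := by
  have h1 : 2 * f + 1 ≤ _ := hb.2.2.2 (by omega)
  rw [Set.ncard_eq_toFinset_card'] at h1
  refine h1.trans ((Finset.card_le_card ?_).trans (Finset.card_union_le _ _))
  intro v hv
  obtain ⟨p, ⟨hp, hpr⟩, hpv⟩ := Set.mem_toFinset.1 hv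
  by_cases hvC : v ∈ C
  · exact Finset.mem_union_right _ hvC
  · refine Finset.mem_union_left _ (Finset.mem_filter.2
      ⟨Finset.mem_compl.2 hvC, p, hp, hpv, by omega⟩)

open Classical in
theorem Inv.exists_coreBlock {σ : State f Tx} (h : Inv σ) {r : ℕ} (hr : 1 ≤ r)
    (hc : CoinRevealed σ r) : ∃ b, CoreBlock σ r b := by
  by_contra! hcon
  have hmiss : ∀ v, v ∉ σ.corrupted → ∃ d ∈ σ.created, d.author ∉ σ.corrupted ∧
      d.round = r + 2 ∧ ∀ b ∈ σ.created, b.author = v → b.round = r → ¬ InHistory b d := by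
    intro v hv
    by_cases hex : ∃ b ∈ σ.created, b.author = v ∧ b.round = r
    · obtain ⟨b, hb, rfl, hbr⟩ := hex
      have h1 := hcon b
      simp only [CoreBlock, not_and, not_forall] at h1
      obtain ⟨d, hd, h2, h3, h4⟩ := h1 hb hbr hv
      refine ⟨d, hd, h2, h3, fun b' hb' h5 h6 => ?_⟩
      rwa [h.unique b' hb' b hb h5 (h6.trans hbr.symm)]
    · obtain ⟨d, hd, -, h1, h2⟩ := hc.exists_creator h (k := 2) (by omega) (by omega)
        (S := Set.univ) (by
          rw [Set.ncard_univ, Nat.card_eq_fintype_card, Fintype.card_fin]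
          omega)
      exact ⟨d, hd, h1, h2, fun b hb h3 h4 => absurd ⟨b, hb, h3, h4⟩ hex⟩
  have : Nonempty (Block f Tx) := ⟨.mk 0 0 [] []⟩
  choose! F hF hFc hFr hFm using hmiss
  obtain ⟨C, hC⟩ : ∃ C : Finset (Validator f), ∀ v, v ∈ C ↔ v ∈ σ.corrupted :=
    ⟨σ.corrupted.toFinset, fun v => Set.mem_toFinset⟩
  have hCf : C.card ≤ f := by
    have h1 := h.card_corrupted
    rw [Set.ncard_eq_toFinset_card'] at h1
    convert h1 using 2
    ext v
    simp [hC]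
  have hU : C.card + Cᶜ.card = 3 * f + 1 := by
    rw [Finset.card_add_card_compl, Fintype.card_fin]
  let P : Validator f → Validator f → Prop := fun v i =>
    ∃ p ∈ (F v).parents, p.author = i ∧ p.round = r + 1
  have hrow : ∀ v ∈ Cᶜ, 2 * f + 1 - C.card ≤ (Cᶜ.bipartiteAbove P v).card := by
    intro v hv
    have hv' : v ∉ σ.corrupted := fun hv' => Finset.mem_compl.1 hv ((hC v).2 hv')
    have := (wellFormed_of_mem_localDag (h.mem_dag _ (hF v hv'))).card_parents
      (r := r + 1) (hFr v hv') (by omega) C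
    exact Nat.sub_le_iff_le_add.2 this
  have hcol : ∀ i ∈ Cᶜ, (Cᶜ.bipartiteBelow P i).card ≤ Cᶜ.card - (2 * f + 1 - C.card) := by
    intro i hi
    have hi' : i ∉ σ.corrupted := fun hi' => Finset.mem_compl.1 hi ((hC i).2 hi')
    by_cases hne : (Cᶜ.bipartiteBelow P i).Nonempty
    · obtain ⟨v, hv⟩ := hne
      obtain ⟨hv, p, hp, hpi, hpr⟩ := Finset.mem_filter.1 hv
      have hv' : v ∉ σ.corrupted := fun hv' => Finset.mem_compl.1 hv ((hC v).2 hv')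
      have hdag := h.mem_dag _ (hF v hv')
      have hpc : p ∈ σ.created :=
        h.author_created hdag (.of_mem_parents hp) (hpi ▸ hi')
      set Q := Cᶜ.filter fun v => ∃ p' ∈ p.parents, p'.author = v ∧ p'.round = r with hQ
      have h1 : 2 * f + 1 ≤ Q.card + C.card := (hdag p (.of_mem_parents hp)).2.card_parents hpr hr C
      have hsub : Cᶜ.bipartiteBelow P i ⊆ Cᶜ \ Q := by
        intro u hu
        obtain ⟨hu, p', hp', hpi', hpr'⟩ := Finset.mem_filter.1 hu
        have hu' : u ∉ σ.corrupted := fun hu' => Finset.mem_compl.1 hu ((hC u).2 hu')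
        have hdag' := h.mem_dag _ (hF u hu')
        have hpc' : p' ∈ σ.created :=
          h.author_created hdag' (.of_mem_parents hp') (hpi' ▸ hi')
        obtain rfl := h.unique p' hpc' p hpc (hpi'.trans hpi.symm) (hpr'.trans hpr.symm)
        refine Finset.mem_sdiff.2 ⟨hu, fun huQ => ?_⟩
        obtain ⟨-, b, hb, hbu, hbr⟩ := Finset.mem_filter.1 huQ
        have hbF : InHistory b (F u) := (InHistory.of_mem_parents hb).trans (.of_mem_parents hp')
        exact hFm u hu' b (h.author_created hdag' hbF (hbu ▸ hu')) hbu hbr hbF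
      have h2 := Finset.card_le_card hsub
      rw [Finset.card_sdiff_of_subset (show Q ⊆ Cᶜ from Finset.filter_subset _ _)] at h2
      omega
    · rw [Finset.not_nonempty_iff_eq_empty.1 hne]
      simp
  have h1 := Finset.card_mul_le_card_mul P hrow hcol
  have h2 := Nat.le_of_mul_le_mul_left h1 (by omega)
  omega

/-- After the coin of round `r` has been revealed, and if no further validator is corrupted, all
blocks of round `r + 3` vote for the core block. -/
theorem CoreBlock.isVote {σ σ' : State f Tx} (h : Inv σ) (h' : Inv σ') (hg : Grows σ σ')
    (hcor : σ'.corrupted ⊆ σ.corrupted) {r : ℕ} (hc : CoinRevealed σ r) {b : Block f Tx}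
    (hb : CoreBlock σ r b) {w : Validator f} {p : Block f Tx} (hp : p ∈ σ'.dag w)
    (hpr : p.round = voteRound r) : IsVote p b := by
  obtain ⟨hbc, hbr, hba, hcore⟩ := hb
  have hpr' : p.round = r + 3 := hpr
  have hwf := fun x hx => (hp x hx).2
  refine isVote_of_unique hwf ?_ (by omega) ?_
  · have hq : 2 * f + 1 ≤ _ := (hwf p (.refl p)).2.2.2 (by omega)
    obtain ⟨d, hd, ⟨q, ⟨hqp, hqr⟩, hqd⟩, hdc, hdr⟩ :=
      hc.exists_creator h (k := 2) (by omega) (by omega) hq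
    have hqc : q ∈ σ'.created := by
      refine h'.author_created hp (.of_mem_parents hqp) ?_
      rw [hqd]
      exact fun hh => hdc (hcor hh)
    obtain rfl := h'.unique q hqc d (hg.created hd) hqd (by omega)
    exact (hcore q hd hdc hdr).trans (.of_mem_parents hqp)
  · intro x hx hxa hxr
    refine h'.unique x (h'.author_created hp hx ?_) b (hg.created hbc) hxa hxr
    rw [hxa]
    exact fun hh => hba (hcor hh)

theorem CoreBlock.isCert {σ σ' : State f Tx} (h : Inv σ) (h' : Inv σ') (hg : Grows σ σ')
    (hcor : σ'.corrupted ⊆ σ.corrupted) {r : ℕ} (hc : CoinRevealed σ r) {b : Block f Tx}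
    (hb : CoreBlock σ r b) {w : Validator f} {d : Block f Tx} (hd : d ∈ σ'.dag w)
    (hdr : d.round = certifyRound r) : IsCert d b := by
  have hbr := hb.2.1
  have hdr' : d.round = r + 4 := hdr
  refine ⟨hbr ▸ hdr, (((hd d (.refl d)).2.2.2.2 (by omega))).mono ?_⟩
  rintro p ⟨hp, hpr⟩
  have hpv : p.round = voteRound r := by
    rw [voteRound]
    omega
  exact ⟨hp, hbr ▸ hpv,
    hb.isVote h h' hg hcor hc (mem_dag_of_inHistory hd (.of_mem_parents hp)) hpv⟩

end Core

/-! ### Deciding all slots before five committed ones -/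

section Deciding

variable {f : ℕ} {Tx : Type*} {ℓ : ℕ}

theorem Slot.before_wf : WellFounded (Slot.Before (ℓ := ℓ)) := by
  refine Subrelation.wf ?_
    (InvImage.wf (fun s : Slot ℓ => (s.round, s.idx.val)) (wellFounded_lt.prod_lex wellFounded_lt))
  rintro s s' (h | ⟨h, h'⟩)
  · exact Prod.Lex.left _ _ h
  · simp only [InvImage, h]
    exact Prod.Lex.right _ h'

variable {e : Election} {c : ℕ → Coin f} {G : Set (Block f Tx)}

/-- A slot whose coin is available is decided if some later slot is committed and all slots in
between that may be anchors are decided. -/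
theorem exists_decided_of_anchor {u s : Slot ℓ} (hu : 1 ≤ u.round) (hav : CoinAvailable G u.round)
    (hs : certifyRound u.round < s.round) {l : Block f Tx} (hl : Decided e c G s (some l))
    (hbetween : ∀ s' : Slot ℓ, certifyRound u.round < s'.round → s'.Before s →
      ∃ x, Decided e c G s' x) :
    ∃ x, Decided e c G u x := by
  by_cases hskip : DirectSkip e c G u
  · exact ⟨none, .directSkip hskip⟩
  by_cases hcommit : ∃ b, DirectCommit e c G u b
  · obtain ⟨b, hb⟩ := hcommit
    exact ⟨some b, .directCommit hb⟩
  have hund : DirectUndecided e c G u := ⟨hu, hav, hskip, not_exists.1 hcommit⟩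
  obtain ⟨s', ⟨hs', a, ha⟩, hmin⟩ := Slot.before_wf.has_min
    {s' : Slot ℓ | certifyRound u.round < s'.round ∧ ∃ a, Decided e c G s' (some a)} ⟨s, hs, l, hl⟩
  have hfirst : ∀ x : Slot ℓ, certifyRound u.round < x.round → x.Before s' →
      Decided e c G x none := by
    intro x hx hxs
    have hxs' : x.Before s := by
      have h1 := hmin s ⟨hs, l, hl⟩
      unfold Slot.Before at *
      omega
    obtain ⟨y, hy⟩ := hbetween x hx hxs'
    cases y with
    | none => exact hy
    | some y => exact absurd hxs (hmin x ⟨hx, y, hy⟩)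
  by_cases hlink : ∃ b ∈ leaderBlocks e c G u, CertifiedLink G a b
  · obtain ⟨b, hb, hab⟩ := hlink
    exact ⟨some b, .indirectCommit hund hs' hfirst ha hb hab⟩
  · exact ⟨none, .indirectSkip hund hs' hfirst ha fun b hb hab => hlink ⟨b, hb, hab⟩⟩

theorem exists_decided_of_five (hℓ : 0 < ℓ) {r : ℕ}
    (hav : ∀ k, 1 ≤ k → k < r → CoinAvailable G k)
    (hcommit : ∀ i < 5, ∃ b, Decided e c G (⟨r + i, ⟨0, hℓ⟩⟩ : Slot ℓ) (some b)) (m : ℕ) :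
    ∀ u : Slot ℓ, 1 ≤ u.round → u.round < r → r ≤ u.round + m → ∃ x, Decided e c G u x := by
  induction m with
  | zero => exact fun u _ h1 h2 => absurd h1 (by omega)
  | succ m ih =>
    intro u hu hur hm
    by_cases h5 : u.round + 5 ≤ r
    · obtain ⟨b, hb⟩ := hcommit 0 (by omega)
      refine exists_decided_of_anchor hu (hav _ hu hur) (s := ⟨r + 0, ⟨0, hℓ⟩⟩) ?_ hb ?_
      · simp only [certifyRound]
        omega
      · rintro s' h1 (h2 | ⟨-, h2⟩)
        · simp only [certifyRound] at h1 h2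
          exact ih s' (by omega) (by omega) (by omega)
        · exact absurd h2 (Nat.not_lt_zero _)
    · obtain ⟨b, hb⟩ := hcommit (u.round + 5 - r) (by omega)
      refine exists_decided_of_anchor hu (hav _ hu hur)
        (s := ⟨r + (u.round + 5 - r), ⟨0, hℓ⟩⟩) ?_ hb ?_
      · simp only [certifyRound]
        omega
      · rintro s' h1 (h2 | ⟨-, h2⟩)
        · simp only [certifyRound] at h1 h2
          omega
        · exact absurd h2 (Nat.not_lt_zero _)

/-- A block in the history of a committed leader is delivered if all earlier slots are decided. -/
theorem exists_deliveredAt {s : Slot ℓ} {b l : Block f Tx} (hs : Decided e c G s (some l))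
    (hbl : InHistory b l)
    (hdec : ∀ u : Slot ℓ, 1 ≤ u.round → u.Before s → ∃ x, Decided e c G u x) :
    ∃ s' l', DeliveredAt (ℓ := ℓ) e c G b s' l' := by
  obtain ⟨s', ⟨l', hl', hb'⟩, hmin⟩ := Slot.before_wf.has_min
    {s' : Slot ℓ | ∃ l', Decided e c G s' (some l') ∧ InHistory b l'} ⟨s, l, hs, hbl⟩
  refine ⟨s', l', hl', hb', fun u hu hus => hdec u hu ?_, fun u l'' hus hu hb'' =>
    hmin u ⟨l'', hu, hb''⟩ hus⟩
  have h1 := hmin s ⟨l, hs, hbl⟩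
  unfold Slot.Before at *
  omega

end Deciding

/-! ### Predictable guesses of independent uniform variables -/

section Guessing

open Filter Set
open scoped ENNReal

variable {α : Type*} [Group α] [Fintype α] [MeasurableSpace α] [DiscreteMeasurableSpace α]

/-- The law of a sequence of independent uniformly distributed values. -/
noncomputable def uniformLaw (α : Type*) [Group α] [Fintype α] [MeasurableSpace α] :
    Measure (ℕ → α) :=
  Measure.infinitePi fun _ => (PMF.uniformOfFintype α).toMeasure

instance : IsProbabilityMeasure (uniformLaw α) := by
  unfold uniformLaw
  infer_instance

theorem uniformLaw_cylinder (x : ℕ → α) (s : Finset ℕ) :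
    uniformLaw α {c | ∀ i ∈ s, c i = x i} = (Fintype.card α : ℝ≥0∞)⁻¹ ^ s.card := by
  have h : {c : ℕ → α | ∀ i ∈ s, c i = x i} = Set.pi s fun i => {x i} := by
    ext c
    simp [Set.mem_pi]
  rw [h, uniformLaw, Measure.infinitePi_pi _ (fun i _ => measurableSet_singleton _)]
  simp_rw [PMF.toMeasure_apply_singleton _ _ (measurableSet_singleton _)]
  simp

/-- Sequences whose entries number `r, …, r + 4` are `1` for infinitely many `r`. -/
theorem ae_exists_five_one :
    ∀ᵐ y ∂uniformLaw α, ∀ K, ∃ r ≥ K, ∀ i < 5, y (r + i) = 1 := by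
  set S : ℕ → Set (ℕ → α) := fun k => {y | ∀ i ∈ Finset.Ico (5 * k) (5 * k + 5), y i = 1} with hS
  have hmeas : ∀ k, MeasurableSet (S k) := by
    intro k
    have : S k = ⋂ i ∈ Finset.Ico (5 * k) (5 * k + 5), (fun y : ℕ → α => y i) ⁻¹' {1} := by
      ext y
      simp [hS]
    rw [this]
    exact Finset.measurableSet_biInter _ fun i _ => measurable_pi_apply i (measurableSet_singleton _)
  have hμ : ∀ k, uniformLaw α (S k) = (Fintype.card α : ℝ≥0∞)⁻¹ ^ 5 := by
    intro k
    rw [hS, uniformLaw_cylinder (fun _ => 1)]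
    simp
  have hind : iIndepSet S (uniformLaw α) := by
    rw [iIndepSet_iff_meas_biInter hmeas]
    intro s
    have h1 : ⋂ k ∈ s, S k =
        {y | ∀ i ∈ s.biUnion fun k => Finset.Ico (5 * k) (5 * k + 5), y i = 1} := by
      ext y
      simp only [hS, mem_iInter, mem_ofPred_eq, Finset.mem_biUnion]
      exact ⟨fun h i ⟨k, hk, hi⟩ => h k hk i hi, fun h k hk i hi => h i ⟨k, hk, hi⟩⟩
    rw [h1, uniformLaw_cylinder (fun _ => 1), Finset.card_biUnion]
    · simp [hμ, ← pow_mul, mul_comm]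
    · intro a _ b _ hab
      refine Finset.disjoint_left.2 fun i hi hi' => hab ?_
      simp only [Finset.mem_Ico] at hi hi'
      omega
  have hsum : ∑' k, uniformLaw α (S k) = ∞ := by
    simp_rw [hμ]
    refine ENNReal.tsum_const_eq_top_of_ne_zero ?_
    exact pow_ne_zero _ (ENNReal.inv_ne_zero.2 (ENNReal.natCast_ne_top _))
  have hlim := measure_limsup_eq_one hmeas hind hsum
  have hae : ∀ᵐ y ∂uniformLaw α, y ∈ limsup S atTop := by
    rw [← prob_compl_eq_zero_iff (MeasurableSet.measurableSet_limsup hmeas)] at hlim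
    exact hlim
  filter_upwards [hae] with y hy K
  obtain ⟨k, hk, hyk⟩ := (frequently_atTop.1 (mem_limsup_iff_frequently_mem.1 hy)) K
  exact ⟨5 * k, by omega, fun i hi => hyk _ (Finset.mem_Ico.2 (by omega))⟩

variable {h : (ℕ → α) → ℕ → α}

theorem measurable_of_predictable (hh : ∀ c c' r, (∀ i < r, c i = c' i) → h c r = h c' r) (r : ℕ) :
    Measurable fun c => h c r := by
  have : (fun c => h c r) =
      (fun x : Fin r → α => h (fun i => if hi : i < r then x ⟨i, hi⟩ else 1) r) ∘
        fun c (i : Fin r) => c i := by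
    funext c
    exact hh _ _ _ fun i hi => by simp [hi]
  rw [this]
  exact (measurable_of_finite _).comp (measurable_pi_lambda _ fun i => measurable_pi_apply _)

theorem uniformLaw_ext {ν : Measure (ℕ → α)}
    (hν : ∀ (x : ℕ → α) (N : ℕ), ν {c | ∀ i < N, c i = x i} = (Fintype.card α : ℝ≥0∞)⁻¹ ^ N) :
    ν = uniformLaw α := by
  have hN : ∀ N : ℕ, ν.map (fun c (i : Fin N) => c i) =
      (uniformLaw α).map (fun c (i : Fin N) => c i) := by
    intro N
    have hm : Measurable fun (c : ℕ → α) (i : Fin N) => c i :=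
      measurable_pi_lambda _ fun i => measurable_pi_apply _
    refine Measure.ext_of_singleton fun x => ?_
    rw [Measure.map_apply hm (measurableSet_singleton _),
      Measure.map_apply hm (measurableSet_singleton _)]
    set x' : ℕ → α := fun i => if hi : i < N then x ⟨i, hi⟩ else 1 with hx'
    have h1 : (fun (c : ℕ → α) (i : Fin N) => c i) ⁻¹' {x} = {c | ∀ i < N, c i = x' i} := by
      ext c
      simp only [mem_preimage, mem_singleton_iff, mem_ofPred_eq, funext_iff, hx']
      exact ⟨fun h i hi => by simp [hi, ← h ⟨i, hi⟩], fun h i => by simpa using h i i.2⟩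
    have h2 := uniformLaw_cylinder x' (Finset.range N)
    simp only [Finset.mem_range, Finset.card_range] at h2
    rw [h1, hν, h2]
  refine Measure.eq_infinitePi _ fun s t ht => ?_
  rw [← Measure.infinitePi_pi _ fun i _ => ht i]
  change _ = uniformLaw α _
  obtain ⟨N, hN'⟩ : ∃ N, ∀ i ∈ s, i < N :=
    ⟨s.sup id + 1, fun i hi => Nat.lt_succ_of_le (Finset.le_sup (f := id) hi)⟩
  have hm : Measurable fun (c : ℕ → α) (i : Fin N) => c i :=
    measurable_pi_lambda _ fun i => measurable_pi_apply _
  have h1 : Set.pi s t = (fun (c : ℕ → α) (i : Fin N) => c i) ⁻¹'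
      {x | ∀ i, ∀ hi : i ∈ s, x ⟨i, hN' i hi⟩ ∈ t i} := by
    ext c
    simp [Set.mem_pi]
  rw [h1, ← Measure.map_apply hm (Set.toFinite _).measurableSet,
    ← Measure.map_apply hm (Set.toFinite _).measurableSet, hN]

/-- Dividing by a predictable sequence preserves the uniform law. -/
theorem map_predictable (hh : ∀ c c' r, (∀ i < r, c i = c' i) → h c r = h c' r) :
    (uniformLaw α).map (fun c r => (h c r)⁻¹ * c r) = uniformLaw α := by
  have hm : Measurable fun (c : ℕ → α) r => (h c r)⁻¹ * c r := by
    refine measurable_pi_lambda _ fun r => ?_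
    have h1 : Measurable fun p : α × α => p.1⁻¹ * p.2 := measurable_of_finite _
    exact h1.comp ((measurable_of_predictable hh r).prodMk (measurable_pi_apply r))
  refine uniformLaw_ext fun y N => ?_
  rw [Measure.map_apply hm]
  swap
  · have : {c : ℕ → α | ∀ i < N, c i = y i} = ⋂ i ∈ Finset.range N, (fun c => c i) ⁻¹' {y i} := by
      ext c
      simp
    rw [this]
    exact Finset.measurableSet_biInter _ fun i _ => measurable_pi_apply i (measurableSet_singleton _)
  obtain ⟨x, hx⟩ : ∃ x : ℕ → α, ∀ i < N, x i = h x i * y i := by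
    induction N with
    | zero => exact ⟨y, by simp⟩
    | succ N ih =>
      obtain ⟨x, hx⟩ := ih
      have hagree : ∀ i < N, Function.update x N (h x N * y N) i = x i := fun i hi => by
        rw [Function.update_of_ne hi.ne]
      refine ⟨Function.update x N (h x N * y N), fun i hi => ?_⟩
      rcases (Nat.lt_succ_iff.1 hi).lt_or_eq with hi | rfl
      · rw [hagree i hi, hx i hi, hh _ x i fun j hj => hagree j (by omega)]
      · rw [Function.update_self, hh _ x i hagree]
  have hset : (fun (c : ℕ → α) r => (h c r)⁻¹ * c r) ⁻¹' {c | ∀ i < N, c i = y i} =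
      {c | ∀ i ∈ Finset.range N, c i = x i} := by
    ext c
    simp only [mem_preimage, mem_ofPred_eq, Finset.mem_range]
    constructor
    · intro hc i
      induction i using Nat.strong_induction_on with
      | _ i ih =>
        intro hi
        rw [hx i hi, ← hh c x i fun j hj => ih j hj (by omega), ← hc i hi, mul_inv_cancel_left]
    · intro hc i hi
      rw [hc i hi, hx i hi, hh c x i fun j hj => hc j (by omega), inv_mul_cancel_left]
  rw [hset, uniformLaw_cylinder, Finset.card_range]

/-- A strategy that guesses each value from the previous ones is almost surely right five times in
a row infinitely often. -/
theorem ae_exists_five_guesses (hh : ∀ c c' r, (∀ i < r, c i = c' i) → h c r = h c' r) :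
    ∀ᵐ c ∂uniformLaw α, ∀ K, ∃ r ≥ K, ∀ i < 5, c (r + i) = h c (r + i) := by
  have hm : AEMeasurable (fun (c : ℕ → α) r => (h c r)⁻¹ * c r) (uniformLaw α) := by
    refine (measurable_pi_lambda _ fun r => ?_).aemeasurable
    have h1 : Measurable fun p : α × α => p.1⁻¹ * p.2 := measurable_of_finite _
    exact h1.comp ((measurable_of_predictable hh r).prodMk (measurable_pi_apply r))
  have h1 := ae_exists_five_one (α := α)
  rw [← map_predictable hh] at h1
  filter_upwards [ae_of_ae_map hm h1] with c hc K
  obtain ⟨r, hr, h2⟩ := hc K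
  exact ⟨r, hr, fun i hi => (inv_mul_eq_one.1 (h2 i hi)).symm⟩

end Guessing

/-! ### Leaders in the common core -/

section Leaders

variable {f : ℕ} {Tx : Type*} {A : Adversary f Tx}

/-- Until the coin of round `r` is revealed, the run depends on the coins of earlier rounds only. -/
theorem history_congr {c c' : ℕ → Coin f} {r : ℕ} (hcc : ∀ i < r, c i = c' i) (t : ℕ)
    (ht : ∀ s < t, ¬ CoinRevealed (stateAt A c s) r) : history A c t = history A c' t := by
  induction t with
  | zero => rfl
  | succ t ih =>
    have h1 := ih fun s hs => ht s (by omega)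
    have h2 : coinView (stateAfter (history A c t)) c = coinView (stateAfter (history A c t)) c' := by
      funext i
      unfold coinView
      split_ifs with hi
      · rw [hcc i]
        by_contra hri
        exact ht t (by omega) (CoinRevealed.of_le (inv_stateAt A c t) (by omega) hi)
      · rfl
    rw [history, history, h2, h1]

/-- When the coin of round `r` is revealed, validator `v` is the author of a core block. -/
def CoreAt (A : Adversary f Tx) (c : ℕ → Coin f) (r : ℕ) (v : Validator f) : Prop :=
  ∃ t, (∀ s < t, ¬ CoinRevealed (stateAt A c s) r) ∧ CoinRevealed (stateAt A c t) r ∧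
    ∃ b, CoreBlock (stateAt A c t) r b ∧ b.author = v

theorem CoreAt.congr {c c' : ℕ → Coin f} {r : ℕ} (hcc : ∀ i < r, c i = c' i) {v : Validator f}
    (h : CoreAt A c r v) : CoreAt A c' r v := by
  obtain ⟨t, ht, h1⟩ := h
  have hst : ∀ s ≤ t, stateAt A c s = stateAt A c' s := fun s hs =>
    congrArg stateAfter (history_congr hcc s fun s' hs' => ht s' (by omega))
  refine ⟨t, fun s hs => hst s hs.le ▸ ht s hs, ?_⟩
  rwa [← hst t le_rfl]

open Classical in
/-- A coin value that elects a validator with property `P`, if there is one. -/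
noncomputable def electing (P : Validator f → Prop) : Coin f :=
  if h : ∃ v, P v then Equiv.swap 0 h.choose else 1

theorem electing_spec {P : Validator f → Prop} (h : ∃ v, P v) : P (electing P 0) := by
  rw [electing, dif_pos h, Equiv.swap_apply_left]
  exact h.choose_spec

instance (f : ℕ) : DiscreteMeasurableSpace (Coin f) := ⟨fun _ => trivial⟩

theorem ae_exists_core_leaders (A : Adversary f Tx) :
    ∀ᵐ c ∂coinLaw f, ∀ K, ∃ r ≥ K, ∀ i < 5, (∃ v, CoreAt A c (r + i) v) →
      CoreAt A c (r + i) (c (r + i) 0) := by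
  have h := ae_exists_five_guesses (h := fun c r => electing (CoreAt A c r)) fun c c' r hcc => by
    congr 1
    funext v
    exact propext ⟨fun h => h.congr hcc, fun h => h.congr fun i hi => (hcc i hi).symm⟩
  filter_upwards [h] with c hc K
  obtain ⟨r, hr, h1⟩ := hc K
  refine ⟨r, hr, fun i hi hex => ?_⟩
  have h2 := electing_spec hex
  rwa [← h1 i hi] at h2

theorem Election.leader_zero (e : Election) (c : Coin f) : e.leader c 0 = c 0 := by
  cases e <;> simp [Election.leader]

variable {c : ℕ → Coin f}

theorem coinRevealed_of_honest {t r : ℕ} (h : ∀ v, Honest A c v →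
    ∃ b ∈ (stateAt A c t).created, b.author = v ∧ b.round = certifyRound r) :
    CoinRevealed (stateAt A c t) r :=
  (honest_card A c).trans (Set.ncard_le_ncard (fun v hv => Or.inr (h v hv)) (Set.toFinite _))

/-- If the first leader of a round whose coin is revealed after the last corruption has a core
block, then this block is directly committed by all honest validators. -/
theorem directCommit_of_core {ℓ : ℕ} (hℓ : 0 < ℓ) (e : Election) {w : Validator f} {r s t : ℕ}
    (hr : 1 ≤ r) (hst : s ≤ t) (hstable : ∀ v, v ∉ (stateAt A c s).corrupted → Honest A c v)
    (hrev : CoinRevealed (stateAt A c s) r) {b : Block f Tx} (hb : CoreBlock (stateAt A c s) r b)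
    (hleader : b.author = c r 0)
    (hdag : ∀ v, Honest A c v → ∀ k, 1 ≤ k → k ≤ r + 4 →
      ∃ b ∈ (stateAt A c t).dag w, b ∈ (stateAt A c t).created ∧ b.author = v ∧ b.round = k) :
    DirectCommit e c ((stateAt A c t).dag w) (⟨r, ⟨0, hℓ⟩⟩ : Slot ℓ) b := by
  have hcor : (stateAt A c t).corrupted ⊆ (stateAt A c s).corrupted := by
    intro v hv
    by_contra hvs
    exact hstable v hvs t hv
  have hg : Grows (stateAt A c s) (stateAt A c t) := grows_stateAt hst
  have hs := inv_stateAt A c s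
  have ht := inv_stateAt A c t
  refine ⟨hr, ?_, ⟨?_, hb.2.1, ?_⟩, ?_⟩
  · refine HasQuorum.of_honest (A := A) (c := c) fun v hv => ?_
    obtain ⟨d, hd, -, h1, h2⟩ := hdag v hv (r + 4) (by omega) le_rfl
    exact ⟨d, ⟨hd, h2⟩, h1⟩
  · obtain ⟨d, hd, hd', h1, h2⟩ := hdag b.author (hstable _ hb.2.2.1) r hr (by omega)
    rwa [← ht.unique d hd' b (hg.created hb.1) h1 (h2.trans hb.2.1.symm)]
  · rw [hleader, Election.leader_zero]
  · refine HasQuorum.of_honest (A := A) (c := c) fun v hv => ?_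
    obtain ⟨d, hd, -, h1, h2⟩ := hdag v hv (r + 4) (by omega) le_rfl
    exact ⟨d, ⟨hd, hb.isCert hs ht hg hcor hrev hd h2⟩, h1⟩

/-- In an admissible run in which five consecutive first leaders are infinitely often in the common
core, all blocks of honest validators are delivered. -/
theorem delivers_of_core_leaders {ℓ : ℕ} (hℓ : 0 < ℓ) (e : Election)
    (hcore : ∀ K, ∃ r ≥ K, ∀ i < 5, (∃ v, CoreAt A c (r + i) v) →
      CoreAt A c (r + i) (c (r + i) 0))
    (hA : Admissible A c) {v w : Validator f} {b : Block f Tx} (hv : Honest A c v)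
    (hb : Broadcasts A c v b) (hw : Honest A c w) : Delivers A ℓ e c w b := by
  obtain ⟨rfl, tb, hb⟩ := hb
  obtain ⟨t₀, hstable⟩ := exists_corrupted_stable A c
  obtain ⟨t₁, hdag₁⟩ := exists_forall_of_eventually
    (P := fun (u : Validator f) t => Honest A c u → b ∈ (stateAt A c t).dag u)
    (fun u s t hst h hu => (grows_stateAt hst).dag u (h hu)) (fun u => by
      by_cases hu : Honest A c u
      · obtain ⟨t, ht⟩ := exists_mem_dag_of_created hA hb hv hu
        exact ⟨t, fun _ => ht⟩
      · exact ⟨0, fun h => absurd h hu⟩)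
  obtain ⟨T, hT₀, hT₁, hTb⟩ : ∃ T, t₀ ≤ T ∧ t₁ ≤ T ∧ tb ≤ T := ⟨t₀ + t₁ + tb, by omega⟩
  obtain ⟨M, hM⟩ := ((inv_stateAt A c T).finite.image Block.round).bddAbove
  have hlate : ∀ s, ∀ d ∈ (stateAt A c s).created, M < d.round → T < s := by
    intro s d hd hdM
    by_contra! hsT
    exact absurd (hM ⟨d, (grows_stateAt hsT).created hd, rfl⟩) (by omega)
  obtain ⟨r, hrM, hr⟩ := hcore (M + 1)
  obtain ⟨t₂, ht₂⟩ := exists_mem_dag hA hw (r + 8)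
  have hdag := ht₂ t₂ le_rfl
  have hcommit : ∀ i < 5, ∃ l, DirectCommit e c ((stateAt A c t₂).dag w)
      (⟨r + i, ⟨0, hℓ⟩⟩ : Slot ℓ) l ∧ l.author ∉ (stateAt A c t₀).corrupted ∧
      l ∈ (stateAt A c t₂).created := by
    intro i hi
    have hrev : CoinRevealed (stateAt A c t₂) (r + i) := coinRevealed_of_honest fun u hu => by
      obtain ⟨d, -, hd⟩ := hdag u hu (r + i + 4) (by omega) (by omega)
      exact ⟨d, hd⟩
    classical
    have hex : ∃ s, CoinRevealed (stateAt A c s) (r + i) := ⟨t₂, hrev⟩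
    obtain ⟨l', hl'⟩ := (inv_stateAt A c (Nat.find hex)).exists_coreBlock (by omega)
      (Nat.find_spec hex)
    obtain ⟨s, hs, hsrev, l, hl, hla⟩ := hr i hi ⟨l'.author, Nat.find hex,
      fun s hs => Nat.find_min hex hs, Nat.find_spec hex, l', hl', rfl⟩
    have hst : s ≤ t₂ := by
      by_contra! h
      exact hs t₂ h hrev
    have hTs : T < s := hlate s l hl.1 (by rw [hl.2.1]; omega)
    have hsub : (stateAt A c t₀).corrupted ⊆ (stateAt A c s).corrupted :=
      (grows_stateAt (by omega)).corrupted
    exact ⟨l, directCommit_of_core hℓ e (by omega) hst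
      (fun u hu => hstable u fun h => hu (hsub h)) hsrev hl hla
      (fun u hu k h1 h2 => hdag u hu k h1 (by omega)), fun h => hl.2.2.1 (hsub h),
      (grows_stateAt hst).created hl.1⟩
  obtain ⟨l, hl, hlc, hlcr⟩ := hcommit 0 (by omega)
  have hbl : InHistory b l := by
    obtain ⟨s, -, -, hls, hcan⟩ := exists_create hlcr
    have hlr : l.round = r + 0 := hl.2.2.1.2.1
    have hTs := hlate _ _ hls (by omega)
    have hbd : b ∈ (stateAt A c s).dag l.author :=
      (grows_stateAt (by omega)).dag _ (hdag₁ _ (hstable _ hlc))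
    have hbr : b.round ≤ M := hM ⟨b, (grows_stateAt hTb).created hb, rfl⟩
    exact hcan.2.2.2.2 b hbd (by omega)
  obtain ⟨s, l', h⟩ := exists_deliveredAt (Decided.directCommit hl) hbl (fun u hu hus => by
    refine exists_decided_of_five hℓ (r := r) (fun k hk hkr => ?_) (fun i hi => ?_) r u hu ?_
      (by omega)
    · refine HasQuorum.of_honest (A := A) (c := c) fun x hx => ?_
      obtain ⟨d, hd, -, h1, h2⟩ := hdag x hx (k + 4) (by omega) (by omega)
      exact ⟨d, ⟨hd, h2⟩, h1⟩
    · obtain ⟨l, hl, -⟩ := hcommit i hi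
      exact ⟨l, .directCommit hl⟩
    · rcases hus with h | ⟨-, h⟩
      · exact h
      · exact absurd h (Nat.not_lt_zero _))
  exact ⟨t₂, s, l', h⟩

end Leaders

end MahiMahi

theorem mainTheorem3 {Tx : Type*} (f ℓ : ℕ) (hℓ : 1 ≤ ℓ) (hℓn : ℓ ≤ 3 * f + 1)
    (e : MahiMahi.Election) (A : MahiMahi.Adversary f Tx) :
    ∀ᵐ c ∂(MahiMahi.coinLaw f), MahiMahi.Admissible A c →
      ∀ (v : MahiMahi.Validator f) (b : MahiMahi.Block f Tx),
        MahiMahi.Honest A c v → MahiMahi.Broadcasts A c v b →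
          ∀ w : MahiMahi.Validator f, MahiMahi.Honest A c w → MahiMahi.Delivers A ℓ e c w b := by
  filter_upwards [MahiMahi.ae_exists_core_leaders A] with c hc hA v b hv hb w hw
  exact MahiMahi.delivers_of_core_leaders hℓ e hc hA hv hb hw
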